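/- Let $G$ be a connected (finite-dimensional, real) Lie group with identity element $e$, and let $n$ be a positive integer. Then each connected component of the set $\{g\in G \mid g^n=e\}$, with the subspace topology, is a conjugacy class of $G$. -/

import Mathlib

open scoped Manifold ContDiff

/-! Conjugacy classes are open in `{x | x ^ n = 1}`, hence clopen there, and each is connected as a
continuous image of `G`; so they are the components. For openness near `g`, write `x = u * g` and
let `T` be the derivative at `1` of conjugation by `g`, so `T ^ n = 1`. The map `u ↦ (u * g) ^ n`
has derivative `N = ∑ T ^ i`, and `u ↦ u * g * u⁻¹ * g⁻¹` has derivative `1 - T`. Exactness `ker N =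
im (1 - T)` (vanishing cohomology of a finite cyclic group over `ℝ`) passes from derivatives to the
maps themselves by the local surjectivity theorem. -/

open Filter Topology in
/-- Local exactness: if `T ^ n = 1`, if `φ` and `ψ` have strict derivatives `1 - T` and
`1 + T + ⋯ + T ^ (n - 1)` at a common fixed point `p`, and if `ψ ∘ φ` is constant near `p`, then
the fibre of `ψ` over `p` is near `p` contained in the image under `φ` of any neighbourhood
of `p`. -/
theorem eventually_mem_image_of_strictFDeriv_geom_sum {E : Type*} [NormedAddCommGroup E]
    [NormedSpace ℝ E] [CompleteSpace E] {n : ℕ} (hn : 0 < n) {T : E →L[ℝ] E} (hT : T ^ n = 1)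
    {φ ψ : E → E} {p : E} (hφp : φ p = p) (hφ : HasStrictFDerivAt φ (1 - T) p)
    (hψ : HasStrictFDerivAt ψ (∑ i ∈ Finset.range n, T ^ i) p)
    (hcomp : ∀ᶠ v in 𝓝 p, ψ (φ v) = p) {U : Set E} (hU : U ∈ 𝓝 p) :
    ∀ᶠ v in 𝓝 p, ψ v = p → v ∈ φ '' U := by
  set N : E →L[ℝ] E := ∑ i ∈ Finset.range n, T ^ i with hN
  have hn0 : (n : ℝ) ≠ 0 := by exact_mod_cast hn.ne'
  have hTN : T * N = N := by
    have h := mul_neg_geom_sum T n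
    rw [hT, sub_self, sub_mul, one_mul, sub_eq_zero] at h
    exact h.symm
  have hTiN (i : ℕ) : T ^ i * N = N := by
    induction i with
    | zero => simp
    | succ i ih => rw [pow_succ, mul_assoc, hTN, ih]
  have hNN : N * N = n • N := by
    conv_lhs => enter [1]; rw [hN]
    rw [Finset.sum_mul, Finset.sum_congr rfl fun i _ => hTiN i, Finset.sum_const,
      Finset.card_range]
  have hNN' (v : E) : N (N v) = (n : ℝ) • N v := by
    have := DFunLike.congr_fun hNN v
    simpa [Nat.cast_smul_eq_nsmul] using this
  -- The extra summand `N q.2` turns `φ` into a submersion: every point near `p` is some `f q`, and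
  -- it remains to show that the correction vanishes on the fibre of `ψ`.
  set f : E × E → E := fun q => φ q.1 + N q.2 with hf
  have hfd : HasStrictFDerivAt f ((1 - T).coprod N) (p, 0) := by
    have h1 : HasStrictFDerivAt (fun q : E × E => φ q.1)
        ((1 - T).comp (ContinuousLinearMap.fst ℝ E E)) (p, 0) :=
      HasStrictFDerivAt.comp (p, (0 : E)) (g := φ) (f := Prod.fst) hφ hasStrictFDerivAt_fst
    have h2 : HasStrictFDerivAt (fun q : E × E => N q.2)
        (N.comp (ContinuousLinearMap.snd ℝ E E)) (p, 0) :=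
      HasStrictFDerivAt.comp (p, (0 : E)) (g := N) (f := Prod.snd) N.hasStrictFDerivAt
        hasStrictFDerivAt_snd
    have h3 : (1 - T).coprod N = (1 - T).comp (ContinuousLinearMap.fst ℝ E E) +
        N.comp (ContinuousLinearMap.snd ℝ E E) := by
      ext <;> simp
    rw [h3]
    exact h1.add h2
  have hsurj : ((1 - T).coprod N).range = ⊤ := by
    rw [LinearMap.range_eq_top]
    intro v
    -- Summing `(1 - T) * ∑ j < i, T ^ j = 1 - T ^ i` over `i < n` gives `n - N`.
    refine ⟨((n : ℝ)⁻¹ • (∑ i ∈ Finset.range n, ∑ j ∈ Finset.range i, T ^ j) v,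
      (n : ℝ)⁻¹ • v), ?_⟩
    have h : (1 - T) * (∑ i ∈ Finset.range n, ∑ j ∈ Finset.range i, T ^ j) + N = n • 1 := by
      rw [Finset.mul_sum, hN, ← Finset.sum_add_distrib]
      simp [mul_neg_geom_sum]
    have hv := DFunLike.congr_fun h v
    simp only [ContinuousLinearMap.coe_coe, ContinuousLinearMap.coprod_apply, map_smul,
      ← smul_add]
    rw [inv_smul_eq_iff₀ hn0]
    simpa [Nat.cast_smul_eq_nsmul] using hv
  have hfp : f (p, 0) = p := by simp [hf, hφp]
  have hmap : map f (𝓝 (p, 0)) = 𝓝 p := by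
    rw [hfd.map_nhds_eq_of_surj hsurj, hfp]
  have hfc : Tendsto f (𝓝 (p, 0)) (𝓝 p) := hmap.le
  have hfst : Tendsto (fun q : E × E => q.1) (𝓝 (p, 0)) (𝓝 p) := by
    simpa using (continuous_fst.tendsto (p, (0 : E)))
  have hφc : Tendsto (fun q : E × E => φ q.1) (𝓝 (p, 0)) (𝓝 p) := by
    have := hφ.continuousAt.tendsto
    rw [hφp] at this
    exact this.comp hfst
  have hlo := hψ.isLittleO.comp_tendsto (hfc.prodMk_nhds hφc)
  have hsmall := hlo.def (show (0 : ℝ) < 1 / 2 by norm_num)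
  -- `ψ` agrees at `f q` and `φ q.1`, which differ by `N q.2`, and `N (N q.2) = n • N q.2`. Strict
  -- differentiability thus gives `n * ‖N q.2‖ ≤ 1 / 2 * ‖N q.2‖`, so `N q.2 = 0`.
  have key : ∀ᶠ q in 𝓝 (p, (0 : E)), ψ (f q) = p → f q ∈ φ '' U := by
    filter_upwards [hsmall, hfst.eventually hcomp, hfst.eventually hU] with q hq hcq hqU hψq
    have hn1 : (1 : ℝ) ≤ n := by exact_mod_cast hn
    have hzero : N q.2 = 0 := by
      have e1 : f q - φ q.1 = N q.2 := by simp [hf]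
      simp only [Function.comp, hψq, hcq, sub_self, zero_sub, norm_neg, e1, hNN', norm_smul,
        Real.norm_natCast] at hq
      have := norm_nonneg (N q.2)
      exact norm_eq_zero.1 (by nlinarith)
    exact ⟨q.1, hqU, by simp [hf, hzero]⟩
  rw [← hmap]
  exact key

section LieGroup

open Filter Topology

variable {E : Type*} [NormedAddCommGroup E] [NormedSpace ℝ E]
  {H : Type*} [TopologicalSpace H] (I : ModelWithCorners ℝ E H)
  {G : Type*} [Group G] [TopologicalSpace G] [ChartedSpace H G]

/-- `f : E → G` maps the coordinates `p` of the identity to the identity, and in the preferred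
chart at the identity it is strictly differentiable at `p` with derivative `A`. -/
structure HasDerivAtOne (f : E → G) (A : E →L[ℝ] E) : Prop where
  continuousAt : ContinuousAt f (extChartAt I (1 : G) 1)
  map_one : f (extChartAt I (1 : G) 1) = 1
  hasStrictFDerivAt :
    HasStrictFDerivAt (fun v => extChartAt I (1 : G) (f v)) A (extChartAt I (1 : G) 1)

variable {I}

namespace HasDerivAtOne

theorem tendsto {f : E → G} {A : E →L[ℝ] E} (hf : HasDerivAtOne I f A) :
    Tendsto f (𝓝 (extChartAt I (1 : G) 1)) (𝓝 1) := by
  have := hf.continuousAt.tendsto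
  rwa [hf.map_one] at this

theorem eventually_mem_source {f : E → G} {A : E →L[ℝ] E} (hf : HasDerivAtOne I f A) :
    ∀ᶠ v in 𝓝 (extChartAt I (1 : G) 1), f v ∈ (extChartAt I (1 : G)).source :=
  hf.tendsto.eventually (extChartAt_source_mem_nhds (I := I) (1 : G))

theorem unique {f : E → G} {A B : E →L[ℝ] E} (hf : HasDerivAtOne I f A)
    (hg : HasDerivAtOne I f B) : A = B :=
  hf.hasStrictFDerivAt.hasFDerivAt.unique hg.hasStrictFDerivAt.hasFDerivAt

theorem const : HasDerivAtOne I (fun _ : E => (1 : G)) 0 :=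
  ⟨continuousAt_const, rfl, hasStrictFDerivAt_const _ _⟩

variable [I.Boundaryless]

theorem extChartAt_symm : HasDerivAtOne I (extChartAt I (1 : G)).symm 1 where
  continuousAt := continuousAt_extChartAt_symm 1
  map_one := extChartAt_to_inv 1
  hasStrictFDerivAt := by
    refine (hasStrictFDerivAt_id _).congr_of_eventuallyEq ?_
    filter_upwards [extChartAt_target_mem_nhds (I := I) (1 : G)] with v hv
    exact ((extChartAt I (1 : G)).right_inv hv).symm

variable [LieGroup I ∞ G]

/-- A smooth self-map of `G` fixing the identity acts on derivatives at the identity by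
composition with its own derivative. -/
theorem exists_comp {s : G → G} (hs : ContMDiff I I ∞ s) (hs1 : s 1 = 1) :
    ∃ T : E →L[ℝ] E, ∀ (f : E → G) (A : E →L[ℝ] E), HasDerivAtOne I f A →
      HasDerivAtOne I (fun v => s (f v)) (T * A) := by
  have : IsManifold I ∞ G := LieGroup.toContMDiffMul.toIsManifold
  set e := extChartAt I (1 : G) with he
  have hsymm : ContMDiffAt 𝓘(ℝ, E) I ∞ e.symm (e 1) :=
    (contMDiffOn_extChartAt_symm (1 : G)).contMDiffAt (extChartAt_target_mem_nhds (1 : G))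
  have hes : e.symm (e 1) = 1 := extChartAt_to_inv 1
  have hsm : ContMDiffAt 𝓘(ℝ, E) 𝓘(ℝ, E) ∞ (fun v => e (s (e.symm v))) (e 1) := by
    refine ContMDiffAt.comp (I' := I) (e 1) (g := e) ?_ (ContMDiffAt.comp (e 1) hs.contMDiffAt hsymm)
    simp only [hes, hs1]
    exact contMDiffAt_extChartAt
  have hstrict := hsm.contDiffAt.hasStrictFDerivAt (by simp)
  refine ⟨fderiv ℝ (fun v => e (s (e.symm v))) (e 1), fun f A hf => ⟨?_, ?_, ?_⟩⟩
  · exact hs.continuous.continuousAt.comp hf.continuousAt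
  · rw [hf.map_one, hs1]
  · have hf1 : e (f (e 1)) = e 1 := by rw [hf.map_one]
    have hc := HasStrictFDerivAt.comp (e 1) (g := fun v => e (s (e.symm v)))
      (f := fun v => e (f v)) (by simp only [hf1]; exact hstrict) hf.hasStrictFDerivAt
    refine hc.congr_of_eventuallyEq ?_
    filter_upwards [hf.eventually_mem_source] with v hv
    rw [e.left_inv hv]

/-- Multiplication restricts to the identity on each factor, so its derivative at `(1, 1)` is
addition. -/
theorem mul {f g : E → G} {A B : E →L[ℝ] E} (hf : HasDerivAtOne I f A)
    (hg : HasDerivAtOne I g B) : HasDerivAtOne I (fun v => f v * g v) (A + B) := by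
  have : IsManifold I ∞ G := LieGroup.toContMDiffMul.toIsManifold
  have : IsTopologicalGroup G := topologicalGroup_of_lieGroup I ∞
  set e := extChartAt I (1 : G) with he
  have hes : e.symm (e 1) = 1 := extChartAt_to_inv 1
  set m : E × E → E := fun q => e (e.symm q.1 * e.symm q.2) with hm
  have hsymm : ContMDiffAt 𝓘(ℝ, E) I ∞ e.symm (e 1) :=
    (contMDiffOn_extChartAt_symm (1 : G)).contMDiffAt (extChartAt_target_mem_nhds (1 : G))
  have hfst : ContMDiffAt 𝓘(ℝ, E × E) I ∞ (fun q : E × E => e.symm q.1) (e 1, e 1) :=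
    ContMDiffAt.comp (I' := 𝓘(ℝ, E)) (e 1, e 1) (g := e.symm) (f := Prod.fst) hsymm
      contDiffAt_fst.contMDiffAt
  have hsnd : ContMDiffAt 𝓘(ℝ, E × E) I ∞ (fun q : E × E => e.symm q.2) (e 1, e 1) :=
    ContMDiffAt.comp (I' := 𝓘(ℝ, E)) (e 1, e 1) (g := e.symm) (f := Prod.snd) hsymm
      contDiffAt_snd.contMDiffAt
  have hmsm : ContMDiffAt 𝓘(ℝ, E × E) 𝓘(ℝ, E) ∞ m (e 1, e 1) := by
    refine ContMDiffAt.comp (I' := I) (e 1, e 1) (g := e) ?_ (hfst.mul hsnd)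
    simp only [hes, mul_one]
    exact contMDiffAt_extChartAt
  have hstrict := hmsm.contDiffAt.hasStrictFDerivAt (by simp)
  set M := fderiv ℝ m (e 1, e 1)
  have htgt := extChartAt_target_mem_nhds (I := I) (1 : G)
  have hM1 : M.comp (ContinuousLinearMap.inl ℝ E E) = .id ℝ E := by
    have h := HasFDerivAt.comp (e 1) (g := m) (f := fun v => (v, e 1)) hstrict.hasFDerivAt
      (hasFDerivAt_prodMk_left (e 1) (e 1))
    refine h.unique ((hasFDerivAt_id (e 1)).congr_of_eventuallyEq ?_)
    filter_upwards [htgt] with v hv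
    simp [hm, hes, e.right_inv hv]
  have hM2 : M.comp (ContinuousLinearMap.inr ℝ E E) = .id ℝ E := by
    have h := HasFDerivAt.comp (e 1) (g := m) (f := fun v => (e 1, v)) hstrict.hasFDerivAt
      (hasFDerivAt_prodMk_right (e 1) (e 1))
    refine h.unique ((hasFDerivAt_id (e 1)).congr_of_eventuallyEq ?_)
    filter_upwards [htgt] with v hv
    simp [hm, hes, e.right_inv hv]
  have hMv (v w : E) : M (v, w) = v + w := by
    have h1 := DFunLike.congr_fun hM1 v
    have h2 := DFunLike.congr_fun hM2 w
    simp only [ContinuousLinearMap.comp_apply, ContinuousLinearMap.inl_apply,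
      ContinuousLinearMap.inr_apply, ContinuousLinearMap.id_apply] at h1 h2
    calc M (v, w) = M ((v, 0) + (0, w)) := by simp
      _ = v + w := by rw [map_add, h1, h2]
  refine ⟨hf.continuousAt.mul hg.continuousAt, by rw [hf.map_one, hg.map_one, mul_one], ?_⟩
  have hf1 : e (f (e 1)) = e 1 := by rw [hf.map_one]
  have hg1 : e (g (e 1)) = e 1 := by rw [hg.map_one]
  have hc := HasStrictFDerivAt.comp (e 1) (g := m) (f := fun v => (e (f v), e (g v)))
    (by simp only [hf1, hg1]; exact hstrict) (hf.hasStrictFDerivAt.prodMk hg.hasStrictFDerivAt)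
  have hAB : M.comp (A.prod B) = A + B := by
    ext v
    simp [hMv]
  rw [hAB] at hc
  refine hc.congr_of_eventuallyEq ?_
  filter_upwards [hf.eventually_mem_source, hg.eventually_mem_source] with v hv hw
  simp only [hm]
  rw [e.left_inv hv, e.left_inv hw]

theorem inv {f : E → G} {A : E →L[ℝ] E} (hf : HasDerivAtOne I f A) :
    HasDerivAtOne I (fun v => (f v)⁻¹) (-A) := by
  -- Inversion has some derivative `T`; differentiating `f * f⁻¹ = 1` forces `T * A = -A`.
  obtain ⟨T, hT⟩ := exists_comp (contMDiff_inv (G := G) I ∞) inv_one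
  have h := hf.mul (hT f A hf)
  simp only [mul_inv_cancel] at h
  have := h.unique const
  rw [neg_eq_of_add_eq_zero_right this]
  exact hT f A hf

end HasDerivAtOne

open HasDerivAtOne in
/-- In a Lie group, elements of `{x | x ^ n = 1}` close to `g` are conjugate to `g`. -/
theorem eventually_isConj_of_pow_eq_one [CompleteSpace E] [I.Boundaryless] [LieGroup I ∞ G]
    {n : ℕ} (hn : 0 < n) {g : G} (hg : g ^ n = 1) :
    ∀ᶠ x in 𝓝 g, x ^ n = 1 → IsConj g x := by
  have : IsTopologicalGroup G := topologicalGroup_of_lieGroup I ∞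
  obtain ⟨T, hT⟩ := exists_comp (I := I) (s := fun x : G => g * x * g⁻¹)
    ((contMDiff_const.mul contMDiff_id).mul contMDiff_const) (by simp)
  set e := extChartAt I (1 : G) with he
  have hes : e.symm (e 1) = 1 := extChartAt_to_inv 1
  have hconj (i : ℕ) : HasDerivAtOne I (fun v => g ^ i * e.symm v * (g ^ i)⁻¹) (T ^ i) := by
    induction i with
    | zero =>
      simp only [pow_zero, one_mul, inv_one, mul_one]
      exact extChartAt_symm
    | succ i ih =>
      rw [pow_succ' T]
      convert hT _ _ ih using 2
      simp [pow_succ', mul_assoc]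
  have hTn : T ^ n = 1 := by
    have h := hconj n
    simp only [hg, one_mul, inv_one, mul_one] at h
    exact h.unique extChartAt_symm
  -- `(u * g) ^ i * (g ^ i)⁻¹` is the product of the conjugates `g ^ j * u * (g ^ j)⁻¹` for `j < i`.
  have hnorm (i : ℕ) : HasDerivAtOne I (fun v => (e.symm v * g) ^ i * (g ^ i)⁻¹)
      (∑ j ∈ Finset.range i, T ^ j) := by
    induction i with
    | zero => simpa using const (I := I) (G := G)
    | succ i ih =>
      rw [Finset.sum_range_succ]
      convert ih.mul (hconj i) using 2
      simp [pow_succ, mul_assoc]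
  -- Multiplied on the right by `g`, this is the conjugate `u * g * u⁻¹`.
  have hcob : HasDerivAtOne I (fun v => e.symm v * (g * e.symm v * g⁻¹)⁻¹) (1 - T) := by
    have h1 := hconj 1
    simp only [pow_one] at h1
    rw [sub_eq_add_neg]
    exact extChartAt_symm.mul h1.inv
  have hsrc := hcob.eventually_mem_source
  have key := eventually_mem_image_of_strictFDeriv_geom_sum hn hTn
    (by rw [hcob.map_one]) hcob.hasStrictFDerivAt (hnorm n).hasStrictFDerivAt (by
      filter_upwards [hsrc] with v hv
      rw [e.left_inv hv]
      have : e.symm v * (g * e.symm v * g⁻¹)⁻¹ * g = e.symm v * g * (e.symm v)⁻¹ := by group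
      rw [this, conj_pow, hg]
      simp) hsrc
  have hcont : Tendsto (fun x : G => x * g⁻¹) (𝓝 g) (𝓝 1) := by
    have := (continuous_mul_const g⁻¹).tendsto g
    rwa [mul_inv_cancel] at this
  have hechart : Tendsto (fun x : G => e (x * g⁻¹)) (𝓝 g) (𝓝 (e 1)) :=
    (continuousAt_extChartAt (I := I) (1 : G)).tendsto.comp hcont
  filter_upwards [hechart.eventually key,
    hcont.eventually (extChartAt_source_mem_nhds (I := I) (1 : G))] with x hx hxs hxn
  obtain ⟨v, hv, hvx⟩ := hx (by
    rw [e.left_inv hxs, inv_mul_cancel_right, hxn, hg]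
    simp)
  have heq := e.injOn hv hxs hvx
  rw [isConj_iff]
  refine ⟨e.symm v, ?_⟩
  rw [← inv_mul_cancel_right x g, ← heq]
  group

end LieGroup

theorem mainTheorem7 {E : Type*} [NormedAddCommGroup E] [NormedSpace ℝ E] [FiniteDimensional ℝ E]
    {H : Type*} [TopologicalSpace H] (I : ModelWithCorners ℝ E H) [I.Boundaryless]
    {G : Type*} [Group G] [TopologicalSpace G] [ChartedSpace H G] [LieGroup I ∞ G]
    [ConnectedSpace G] (n : ℕ) (hn : 0 < n) (g : G) (hg : g ^ n = 1) :
    connectedComponentIn {x : G | x ^ n = 1} g = conjugatesOf g := by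
  have : CompleteSpace E := FiniteDimensional.complete ℝ E
  have : IsTopologicalGroup G := topologicalGroup_of_lieGroup I ∞
  apply subset_antisymm
  -- Stated for any conjugation-invariant `p`, to cover both the class of `g` and its complement.
  · have hopen (p : G → Prop) (hp : ∀ x y, IsConj x y → p x → p y) :
        IsOpen {x : {x : G | x ^ n = 1} | p x} := by
      rw [isOpen_iff_eventually]
      intro x hx
      have h := continuous_subtype_val.continuousAt.eventually
        (eventually_isConj_of_pow_eq_one (I := I) hn x.2)
      filter_upwards [h] with y hy
      exact hp _ _ (hy y.2) hx
    have hclopen : IsClopen {x : {x : G | x ^ n = 1} | IsConj g x} := by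
      refine ⟨⟨?_⟩, hopen _ fun x y hxy hx => hx.trans hxy⟩
      exact hopen (fun x => ¬ IsConj g x) fun x y hxy hx hy => hx (hy.trans hxy.symm)
    rw [connectedComponentIn_eq_image (show g ∈ {x : G | x ^ n = 1} from hg)]
    rintro _ ⟨x, hx, rfl⟩
    exact hclopen.connectedComponent_subset (x := ⟨g, hg⟩) (IsConj.refl g) hx
  · have hrange : conjugatesOf g = Set.range fun c : G => c * g * c⁻¹ := by
      ext x
      exact isConj_iff
    refine IsPreconnected.subset_connectedComponentIn ?_ mem_conjugatesOf_self ?_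
    · rw [hrange]
      exact isPreconnected_range (by fun_prop)
    · rw [hrange]
      rintro _ ⟨c, rfl⟩
      simp [conj_pow, hg]
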